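/- Let $\mathcal A$ be an additive category. Let $\mathrm{gr}\,\mathcal A$ be the category whose objects are the $\mathbb Z$-graded objects $X=(X^j)_{j\in\mathbb Z}$ of $\mathcal A$, and whose morphisms $f\colon X\to Y$ are the families $f=\{f_0,f_1,f_2,\dots\}$ with $f_n=(f_n^j\colon X^j\to Y^{j+n})_{j\in\mathbb Z}$, with composition $(gf)_n^j=\sum_{p+q=n}g_p^{j+q}f_q^j$ and identities $\{\mathrm{Id},0,0,\dots\}$. Let $\mathrm{gr}^b\mathcal A$ be the full subcategory of those $X$ with only finitely many nonzero $X^j$. It has the automorphism $(1)$ given by $X(1)^j=X^{j+1}$, $f(1)_n^j=f_n^{j+1}$, and the natural transformation $\eta\colon(1)\to\mathrm{Id}$, $\eta_X=\{0,\mathrm{Id},0,0,\dots\}\colon X(1)\to X$. Both $(1)$ and $\eta$ extend degreewise to the category $C(\mathrm{gr}^b\mathcal A)$ of (unbounded) cochain complexes. For a chain map $f\colon K\to L$ write $\mathrm{cone}(f)$ for the complex with $\mathrm{cone}(f)^n=K^{n+1}\oplus L^n$ and differential $\begin{pmatrix}-d_K&0\\ f&d_L\end{pmatrix}$. An $\eta$-conflation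 in $C(\mathrm{gr}^b\mathcal A)$ is a sequence isomorphic to $L\xrightarrow{\binom01}\mathrm{cone}(f)\xrightarrow{(1\ 0)}K[1]$ for some chain map $f\colon K\to L$ that factors through $\eta_L\colon L(1)\to L$. Let $K_\eta(\mathrm{gr}^b\mathcal A)$ be the corresponding stable category: its objects are those of $C(\mathrm{gr}^b\mathcal A)$, and its morphisms are chain maps modulo those that factor through an object that is injective with respect to all $\eta$-conflations. Its suspension functor is induced by $(1)[1]$, and its triangles are the diagrams isomorphic in $K_\eta(\mathrm{gr}^b\mathcal A)$ to $$K\xrightarrow{\ f\ }L\xrightarrow{\binom01}\mathrm{cone}(f\eta_K)\xrightarrow{(1\ 0)}K(1)[1]$$ for some chain map $f\colon K\to L$. Let $\Xi\colon\mathrm{gr}^b\mathcal A\to\mathcal A$ be the functor that sends $X$ to $\bigoplus_jX^j$ and $f\colon X\to Y$ to the lower triangular matrix whose entry $X^j\to Y^k$ is $f_{k-j}^j$ if $k\ge j$ and $0$ otherwise; applied degreewise it gives a functor $\Xi\colon C(\mathrm{gr}^b\mathcal A)\to C(\mathcal A)$. **Proposition.** The functor $\Xi\colon C(\mathrm{gr}^b\mathcal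 A)\to C(\mathcal A)$ induces a triangle functor from $K_\eta(\mathrm{gr}^b\mathcal A)$ to the homotopy category $K(\mathcal A)$. That is, there is a functor $F\colon K_\eta(\mathrm{gr}^b\mathcal A)\to K(\mathcal A)$ such that the composite of the quotient functor $C(\mathrm{gr}^b\mathcal A)\to K_\eta(\mathrm{gr}^b\mathcal A)$ with $F$ equals the composite of $\Xi$ with the quotient functor $C(\mathcal A)\to K(\mathcal A)$, the functor $F$ is additive, and there is a natural isomorphism $\varphi\colon F\circ(1)[1]\cong[1]\circ F$ such that for every triangle $X\xrightarrow{u}Y\xrightarrow{v}Z\xrightarrow{w}X(1)[1]$ of $K_\eta(\mathrm{gr}^b\mathcal A)$ the diagram $F(X)\xrightarrow{F(u)}F(Y)\xrightarrow{F(v)}F(Z)\xrightarrow{\varphi_XF(w)}F(X)[1]$ is a distinguished triangle of $K(\mathcal A)$. -/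

import Mathlib

open CategoryTheory Limits

universe v u v' u'

attribute [instance] hasBinaryBiproducts_of_finite_biproducts

/-! ## Stable categories -/

section Stable

variable {C : Type u} [Category.{v} C] [Preadditive C]

/-- `J` is injective with respect to the class `E` of conflations `S.X₁ ⟶ S.X₂ ⟶ S.X₃`. -/
def RelInjective (E : ObjectProperty (ShortComplex C)) (J : C) : Prop :=
  ∀ ⦃S : ShortComplex C⦄, E S → ∀ g : S.X₁ ⟶ J, ∃ h : S.X₂ ⟶ J, S.f ≫ h = g

/-- Two morphisms are identified in the stable category if their difference factors through an
object that is injective with respect to `E`. -/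
def StableRel (E : ObjectProperty (ShortComplex C)) : HomRel C := fun X Y f g =>
  ∃ (J : C) (a : X ⟶ J) (b : J ⟶ Y), RelInjective E J ∧ f - g = a ≫ b

lemma RelInjective.of_isZero (E : ObjectProperty (ShortComplex C)) {J : C} (h : IsZero J) :
    RelInjective E J := fun _ _ _ => ⟨0, h.eq_of_tgt _ _⟩

lemma RelInjective.biprod [HasBinaryBiproducts C] {E : ObjectProperty (ShortComplex C)} {J J' : C}
    (h : RelInjective E J) (h' : RelInjective E J') : RelInjective E (J ⊞ J') := by
  intro S hS g
  obtain ⟨a, ha⟩ := h hS (g ≫ biprod.fst)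
  obtain ⟨b, hb⟩ := h' hS (g ≫ biprod.snd)
  exact ⟨biprod.lift a b, by ext <;> simp [ha, hb]⟩

lemma StableRel.add [HasBinaryBiproducts C] {E : ObjectProperty (ShortComplex C)} ⦃X Y : C⦄ (f₁ f₂ g₁ g₂ : X ⟶ Y)
    (h : StableRel E f₁ f₂) (h' : StableRel E g₁ g₂) : StableRel E (f₁ + g₁) (f₂ + g₂) := by
  obtain ⟨J, a, b, hJ, h⟩ := h
  obtain ⟨J', a', b', hJ', h'⟩ := h'
  refine ⟨J ⊞ J', biprod.lift a a', biprod.desc b b', hJ.biprod hJ', ?_⟩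
  rw [biprod.lift_desc, ← h, ← h']
  abel

variable [HasZeroObject C] [HasBinaryBiproducts C]

instance StableRel.congruence (E : ObjectProperty (ShortComplex C)) :
    Congruence (StableRel E) where
  equivalence :=
    { refl := fun f => by
        obtain ⟨Z, hZ⟩ := HasZeroObject.zero (C := C)
        exact ⟨Z, 0, 0, RelInjective.of_isZero E hZ, by simp⟩
      symm := by
        rintro f g ⟨J, a, b, hJ, h⟩
        exact ⟨J, -a, b, hJ, by rw [Preadditive.neg_comp, ← h, neg_sub]⟩
      trans := by
        rintro f g k ⟨J, a, b, hJ, h⟩ ⟨J', a', b', hJ', h'⟩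
        refine ⟨J ⊞ J', biprod.lift a a', biprod.desc b b', hJ.biprod hJ', ?_⟩
        rw [biprod.lift_desc, ← h, ← h', sub_add_sub_cancel] }
  comp_left := by
    rintro X Y Z f g g' ⟨J, a, b, hJ, h⟩
    exact ⟨J, f ≫ a, b, hJ, by rw [← Preadditive.comp_sub, h, Category.assoc]⟩
  comp_right := by
    rintro X Y Z f f' g ⟨J, a, b, hJ, h⟩
    exact ⟨J, a, b ≫ g, hJ, by rw [← Preadditive.sub_comp, h, Category.assoc]⟩

/-- The stable category of `C` with respect to the class `E` of conflations: same objects, and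
morphisms modulo those which factor through an `E`-injective object. -/
abbrev StableCategory (E : ObjectProperty (ShortComplex C)) := CategoryTheory.Quotient (StableRel E)

instance (E : ObjectProperty (ShortComplex C)) : Preadditive (StableCategory E) :=
  CategoryTheory.Quotient.preadditive (StableRel E) StableRel.add

end Stable

/-! ## The category `K_η(B)` -/

/-- An endofunctor `(1)` of an additive category `B` with a natural transformation
`η : (1) ⟶ Id` such that `η_{X(1)} = η_X(1)`. (The construction of `K_η(B)`, its suspension and
its triangles does not involve the inverse of `(1)`.) -/
structure Twist (B : Type u) [Category.{v} B] [Preadditive B] where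
  /-- the functor `(1)` -/
  T : B ⥤ B
  additive : T.Additive
  η : T ⟶ 𝟭 B
  comm : ∀ X : B, η.app (T.obj X) = T.map (η.app X)

attribute [instance] Twist.additive

namespace Twist

open CochainComplex.HomComplex

variable {B : Type u} [Category.{v} B] [Preadditive B] (τ : Twist B)

lemma η_app_eq {U W M : B} (p : M ⟶ U) (i : U ⟶ M) (q : M ⟶ W) (r : W ⟶ M)
    (h : p ≫ i + q ≫ r = 𝟙 M) :
    τ.η.app M = τ.T.map q ≫ τ.η.app W ≫ r + τ.T.map p ≫ τ.η.app U ≫ i := by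
  have hi := τ.η.naturality i
  have hr := τ.η.naturality r
  have h' := τ.T.congr_map h
  rw [Functor.map_add, Functor.map_comp, Functor.map_comp, CategoryTheory.Functor.map_id] at h'
  simp only [Functor.id_obj, Functor.id_map] at hi hr
  rw [← hi, ← hr, ← Category.assoc, ← Category.assoc, ← Preadditive.add_comp, add_comm, h']
  exact (Category.id_comp _).symm

/-- The functor `(1)` on complexes. -/
abbrev TC : CochainComplex B ℤ ⥤ CochainComplex B ℤ :=
  τ.T.mapHomologicalComplex (ComplexShape.up ℤ)

/-- The chain map `η_K : K(1) ⟶ K` induced by `η`. -/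
@[simps]
def ηC (K : CochainComplex B ℤ) : τ.TC.obj K ⟶ K where
  f i := τ.η.app (K.X i)
  comm' i j _ := (τ.η.naturality (K.d i j)).symm

lemma ηC_naturality {K L : CochainComplex B ℤ} (f : K ⟶ L) :
    τ.TC.map f ≫ τ.ηC L = τ.ηC K ≫ f := by
  ext i
  exact τ.η.naturality (f.f i)

/-- The functor `(1)[1]` on complexes. -/
noncomputable abbrev suspC : CochainComplex B ℤ ⥤ CochainComplex B ℤ :=
  τ.TC ⋙ shiftFunctor (CochainComplex B ℤ) (1 : ℤ)

variable [HasBinaryBiproducts B]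

/-- The projection `(1 0) : cone(f) ⟶ K[1]`. -/
noncomputable def coneProj {K L : CochainComplex B ℤ} (f : K ⟶ L) :
    CochainComplex.mappingCone f ⟶ (shiftFunctor (CochainComplex B ℤ) (1 : ℤ)).obj K :=
  Cocycle.homOf ((CochainComplex.mappingCone.fst f).rightShift 1 0 (zero_add 1))

lemma inr_coneProj {K L : CochainComplex B ℤ} (f : K ⟶ L) :
    CochainComplex.mappingCone.inr f ≫ coneProj f = 0 := by
  ext n
  simp [coneProj, Cochain.rightShift_v _ 1 0 (zero_add 1) n n (add_zero n) (n + 1) rfl]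
  exact (CochainComplex.mappingCone.inr_f_fst_v_assoc f n (n + 1) rfl _).trans zero_comp

/-- The sequence `L ⟶ cone(f) ⟶ K[1]` given by `(0 1)` and `(1 0)`. -/
noncomputable def stdPair {K L : CochainComplex B ℤ} (f : K ⟶ L) :
    ShortComplex (CochainComplex B ℤ) :=
  ShortComplex.mk (CochainComplex.mappingCone.inr f) (coneProj f) (inr_coneProj f)

/-- The class of `η`-conflations: the sequences isomorphic to
`L ⟶ cone(f) ⟶ K[1]` for some chain map `f : K ⟶ L` which factors through `η_L : L(1) ⟶ L`. -/
def conflation : ObjectProperty (ShortComplex (CochainComplex B ℤ)) := fun S =>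
  ∃ (K L : CochainComplex B ℤ) (f : K ⟶ L) (g : K ⟶ τ.TC.obj L),
    g ≫ τ.ηC L = f ∧ Nonempty (S ≅ stdPair f)


lemma relInjective_of_homotopy {J : CochainComplex B ℤ} (h : Homotopy (τ.ηC J) 0) :
    RelInjective τ.conflation J := by
  rintro S ⟨K, L, f, g, rfl, ⟨e⟩⟩ k
  let e₁ : S.X₁ ⟶ L := e.hom.τ₁
  let e₁' : L ⟶ S.X₁ := e.inv.τ₁
  let e₂ : S.X₂ ⟶ CochainComplex.mappingCone (g ≫ τ.ηC L) := e.hom.τ₂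
  have h1 : S.f ≫ e₂ = e₁ ≫ CochainComplex.mappingCone.inr _ := e.hom.comm₁₂.symm
  have h2 : e₁ ≫ e₁' = 𝟙 _ := congr_arg ShortComplex.Hom.τ₁ e.hom_inv_id
  have h0 : Homotopy ((g ≫ τ.ηC L) ≫ e₁' ≫ k) 0 :=
    (Homotopy.ofEq (by simp only [Category.assoc, ← ηC_naturality])).trans
      ((h.compLeft (g ≫ τ.TC.map (e₁' ≫ k))).trans (Homotopy.ofEq comp_zero))
  obtain ⟨z, hz⟩ := Cochain.equivHomotopy _ _ h0
  refine ⟨e₂ ≫ CochainComplex.mappingCone.desc (g ≫ τ.ηC L) z (e₁' ≫ k)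
    (by simpa using hz.symm), ?_⟩
  rw [reassoc_of% h1, CochainComplex.mappingCone.inr_desc, reassoc_of% h2]

/-- `η` is null-homotopic on the mapping cone of `η_V`. -/
lemma nonempty_homotopy_cone (V : CochainComplex B ℤ) :
    Nonempty (Homotopy (τ.ηC (CochainComplex.mappingCone (τ.ηC V))) 0) := by
  refine ⟨(Cochain.equivHomotopy _ _).symm
    ⟨((CochainComplex.mappingCone.snd (τ.ηC V)).map τ.T).comp
      (CochainComplex.mappingCone.inl (τ.ηC V)) (zero_add (-1)), ?_⟩⟩
  rw [δ_comp _ _ (zero_add (-1)) 1 0 0 (by lia) (by lia) (by lia)]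
  rw [CochainComplex.mappingCone.δ_inl, δ_map, CochainComplex.mappingCone.δ_snd]
  ext n
  have h := τ.η_app_eq _ _ _ _ (CochainComplex.mappingCone.id_X (τ.ηC V) n (n + 1) rfl)
  simp only [Cochain.add_v, Cochain.ofHom_v, HomologicalComplex.zero_f, add_zero]
  have hc : τ.η.app ((τ.TC.obj V).X (n + 1)) = τ.T.map (τ.η.app (V.X (n + 1))) := τ.comm _
  rw [hc] at h
  simp [Cochain.comp_v _ _ (add_neg_cancel 1) n (n + 1) n rfl (by lia)]
  exact h

lemma nonempty_homotopy_of_relInjective {J : CochainComplex B ℤ}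
    (hJ : RelInjective τ.conflation J) : Nonempty (Homotopy (τ.ηC J) 0) := by
  obtain ⟨r, hr⟩ : ∃ r : CochainComplex.mappingCone (τ.ηC J) ⟶ J,
      CochainComplex.mappingCone.inr (τ.ηC J) ≫ r = 𝟙 J :=
    hJ (S := stdPair (τ.ηC J)) ⟨_, _, _, 𝟙 _, by simp, ⟨Iso.refl _⟩⟩ (𝟙 J)
  obtain ⟨h⟩ := τ.nonempty_homotopy_cone J
  refine ⟨(Homotopy.ofEq ?_).trans ((((h.compRight r).compLeft
    (τ.TC.map (CochainComplex.mappingCone.inr (τ.ηC J))))).trans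
      (Homotopy.ofEq (by rw [zero_comp, comp_zero])))⟩
  rw [← Category.assoc, ηC_naturality, Category.assoc, hr, Category.comp_id]

lemma relInjective_suspC {J : CochainComplex B ℤ} (hJ : RelInjective τ.conflation J) :
    RelInjective τ.conflation (τ.suspC.obj J) := by
  obtain ⟨h⟩ := τ.nonempty_homotopy_of_relInjective hJ
  apply τ.relInjective_of_homotopy
  refine (Homotopy.ofEq ?_).trans ((((τ.T.mapHomotopy h).shift 1).compLeft
    ((τ.TC.commShiftIso (1 : ℤ)).hom.app (τ.TC.obj J))).trans (Homotopy.ofEq (by simp)))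
  ext i
  exact (τ.comm _).trans (Category.id_comp _).symm

variable [HasZeroObject B]

instance : HasBinaryBiproducts (CochainComplex B ℤ) := ⟨fun _ _ => inferInstance⟩

/-- The category `K_η(B)`: the stable category of complexes in `B` with respect to the class of
`η`-conflations. -/
abbrev StableK := StableCategory τ.conflation

/-- The canonical functor `C(B) ⥤ K_η(B)`. -/
abbrev quot : CochainComplex B ℤ ⥤ τ.StableK := CategoryTheory.Quotient.functor (StableRel τ.conflation)

/-- The suspension functor of `K_η(B)`, induced by `(1)[1]`. -/
noncomputable def susp : τ.StableK ⥤ τ.StableK :=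
  CategoryTheory.Quotient.lift _ (τ.suspC ⋙ τ.quot) (by
    rintro X Y f g ⟨J, a, b, hJ, h⟩
    refine CategoryTheory.Quotient.sound _ ⟨_, τ.suspC.map a, τ.suspC.map b, τ.relInjective_suspC hJ, ?_⟩
    rw [← Functor.map_sub, h, Functor.map_comp])

/-- The triangles `X ⟶ Y ⟶ Z ⟶ X(1)[1]` of `K_η(B)`: those isomorphic to a standard triangle
`K ⟶ L ⟶ cone(f η_K) ⟶ K(1)[1]` given by a chain map `f : K ⟶ L`, by `(0 1)` and by `(1 0)`. -/
def IsTriangle {X Y Z : τ.StableK} (u : X ⟶ Y) (v : Y ⟶ Z) (w : Z ⟶ τ.susp.obj X) : Prop :=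
  ∃ (K L : CochainComplex B ℤ) (f : K ⟶ L) (a : X ≅ τ.quot.obj K) (b : Y ≅ τ.quot.obj L)
    (c : Z ≅ τ.quot.obj (CochainComplex.mappingCone (τ.ηC K ≫ f))),
    u ≫ b.hom = a.hom ≫ τ.quot.map f ∧
    v ≫ c.hom = b.hom ≫ τ.quot.map (CochainComplex.mappingCone.inr (τ.ηC K ≫ f)) ∧
    w ≫ τ.susp.map a.hom = c.hom ≫ τ.quot.map (coneProj (τ.ηC K ≫ f))

open Pretriangulated in
/-- `F : K_η(B) ⥤ D` is a triangle functor: it is additive, and there is an isomorphism `φ`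
from `F((-)(1)[1])` to `F(-)[1]` such that `F`, together with `φ`, sends triangles to triangles. -/
def IsTriangleFunctor {D : Type u'} [Category.{v'} D] [Preadditive D] [HasZeroObject D]
    [HasShift D ℤ] [∀ n : ℤ, (shiftFunctor D n).Additive] [Pretriangulated D]
    (F : τ.StableK ⥤ D) : Prop :=
  F.Additive ∧ ∃ φ : τ.susp ⋙ F ≅ F ⋙ shiftFunctor D (1 : ℤ),
    ∀ ⦃X Y Z : τ.StableK⦄ (u : X ⟶ Y) (v : Y ⟶ Z) (w : Z ⟶ τ.susp.obj X),
      τ.IsTriangle u v w →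
        Triangle.mk (F.map u) (F.map v) (F.map w ≫ φ.hom.app X) ∈ distTriang D

end Twist

/-! ## Graded objects -/

/-- A `ℤ`-graded object `X = (X^j)` of `A`, as an object of the category `gr A`. -/
structure Gr (A : Type u) where
  obj : ℤ → A

namespace Gr

variable {A : Type u} [Category.{v} A] [Preadditive A]

/-- A morphism `f = {f_0, f_1, …}` of `gr A`, written as a lower triangular `ℤ × ℤ`-matrix:
the component `f_n^j : X^j ⟶ Y^{j+n}` is `entry j (j + n)` for `n ≥ 0`. -/
@[ext]
structure Hom (X Y : Gr A) where
  entry : ∀ j k : ℤ, X.obj j ⟶ Y.obj k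
  entry_eq_zero : ∀ j k : ℤ, k < j → entry j k = 0

/-- The composition `(gf)_n^j = ∑_{p+q=n} g_p^{j+q} f_q^j`, with `k = j + n` and `l = j + q`. -/
noncomputable instance : CategoryStruct (Gr A) where
  Hom := Hom
  id X :=
    { entry := fun j k => if h : j = k then eqToHom (congr_arg X.obj h) else 0
      entry_eq_zero := fun j k h => dif_neg h.ne' }
  comp f g :=
    { entry := fun j k => ∑ l ∈ Finset.Icc j k, f.entry j l ≫ g.entry l k
      entry_eq_zero := fun j k h => by simp [h] }

@[ext]
lemma hom_ext {X Y : Gr A} {f g : X ⟶ Y} (h : ∀ j k, f.entry j k = g.entry j k) : f = g :=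
  Hom.ext (funext fun j => funext fun k => h j k)

@[simp]
lemma id_entry_self (X : Gr A) (j : ℤ) : Hom.entry (𝟙 X) j j = 𝟙 _ := dif_pos rfl

lemma id_entry_of_ne (X : Gr A) {j k : ℤ} (h : j ≠ k) : Hom.entry (𝟙 X) j k = 0 := dif_neg h

lemma comp_entry {X Y Z : Gr A} (f : X ⟶ Y) (g : Y ⟶ Z) (j k : ℤ) :
    Hom.entry (f ≫ g) j k = ∑ l ∈ Finset.Icc j k, f.entry j l ≫ g.entry l k := rfl

noncomputable instance : Category (Gr A) where
  id_comp {X Y} f := by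
    ext j k
    rw [comp_entry]
    by_cases h : j ≤ k
    · rw [Finset.sum_eq_single j]
      · simp
      · intro l _ hl
        rw [id_entry_of_ne _ hl.symm, zero_comp]
      · simp [h]
    · rw [f.entry_eq_zero j k (by lia), Finset.Icc_eq_empty h, Finset.sum_empty]
  comp_id {X Y} f := by
    ext j k
    rw [comp_entry]
    by_cases h : j ≤ k
    · rw [Finset.sum_eq_single k]
      · simp
      · intro l _ hl
        rw [id_entry_of_ne _ hl, comp_zero]
      · simp [h]
    · rw [f.entry_eq_zero j k (by lia), Finset.Icc_eq_empty h, Finset.sum_empty]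
  assoc f g h := by
    ext j k
    simp only [comp_entry, Preadditive.sum_comp, Preadditive.comp_sum, Category.assoc]
    rw [Finset.sum_comm' (t' := Finset.Icc j k) (s' := fun l => Finset.Icc l k)]
    intro a b
    simp only [Finset.mem_Icc]
    lia

instance (X Y : Gr A) : Zero (X ⟶ Y) := ⟨⟨fun _ _ => 0, fun _ _ _ => rfl⟩⟩

instance (X Y : Gr A) : Add (X ⟶ Y) := ⟨fun f g => ⟨fun j k => f.entry j k + g.entry j k,
  fun j k h => by rw [f.entry_eq_zero j k h, g.entry_eq_zero j k h, add_zero]⟩⟩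

instance (X Y : Gr A) : Neg (X ⟶ Y) := ⟨fun f => ⟨fun j k => - f.entry j k,
  fun j k h => by rw [f.entry_eq_zero j k h, neg_zero]⟩⟩

@[simp]
lemma zero_entry {X Y : Gr A} (j k : ℤ) : Hom.entry (0 : X ⟶ Y) j k = 0 := rfl

@[simp]
lemma add_entry {X Y : Gr A} (f g : X ⟶ Y) (j k : ℤ) :
    Hom.entry (f + g) j k = f.entry j k + g.entry j k := rfl

@[simp]
lemma neg_entry {X Y : Gr A} (f : X ⟶ Y) (j k : ℤ) : Hom.entry (-f) j k = -f.entry j k := rfl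

noncomputable instance : Preadditive (Gr A) where
  homGroup X Y :=
    { add_assoc := fun f g h => by ext; simp [add_assoc]
      zero_add := fun f => by ext; simp
      add_zero := fun f => by ext; simp
      add_comm := fun f g => by ext; simp [add_comm]
      neg_add_cancel := fun f => by ext; simp
      nsmul := nsmulRec
      zsmul := zsmulRec }
  add_comp X Y Z f f' g := by
    ext
    simp [comp_entry, Finset.sum_add_distrib]
  comp_add X Y Z f g g' := by
    ext
    simp [comp_entry, Finset.sum_add_distrib]

/-- The functor `(1)` on `gr A`, with `X(1)^j = X^{j+1}` and `f(1)_n^j = f_n^{j+1}`. -/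
noncomputable def shift : Gr A ⥤ Gr A where
  obj X := ⟨fun j => X.obj (j + 1)⟩
  map f := ⟨fun j k => f.entry (j + 1) (k + 1), fun _ _ h => f.entry_eq_zero _ _ (by lia)⟩
  map_id X := by
    ext j k
    by_cases h : j = k
    · subst h
      simp
    · rw [id_entry_of_ne _ h]
      exact id_entry_of_ne _ (by lia)
  map_comp f g := by
    ext j k
    simp only [comp_entry]
    rw [← Finset.image_add_right_Icc, Finset.sum_image (by simp)]

instance : (shift (A := A)).Additive := ⟨rfl⟩

/-- The natural transformation `η_X = {0, Id, 0, …} : X(1) ⟶ X` on `gr A`: the entry from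
`X(1)^j = X^{j+1}` to `X^k` is the identity if `k = j + 1`, and zero otherwise. -/
noncomputable def ηApp (X : Gr A) : shift.obj X ⟶ X where
  entry j k := if h : j + 1 = k then eqToHom (congr_arg X.obj h) else 0
  entry_eq_zero j k h := dif_neg (by lia)

lemma ηApp_entry_self (X : Gr A) (j : ℤ) : (ηApp X).entry j (j + 1) = 𝟙 _ := dif_pos rfl

lemma ηApp_entry_of_ne (X : Gr A) {j k : ℤ} (h : j + 1 ≠ k) : (ηApp X).entry j k = 0 :=
  dif_neg h

lemma ηApp_naturality {X Y : Gr A} (f : X ⟶ Y) : shift.map f ≫ ηApp Y = ηApp X ≫ f := by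
  ext j k
  obtain ⟨m, rfl⟩ : ∃ m, k = m + 1 := ⟨k - 1, by lia⟩
  rw [comp_entry, comp_entry]
  by_cases h : j ≤ m
  · rw [Finset.sum_eq_single m, Finset.sum_eq_single (j + 1)]
    · erw [ηApp_entry_self, ηApp_entry_self, Category.comp_id, Category.id_comp]
      rfl
    · intro l _ hl
      rw [ηApp_entry_of_ne _ hl.symm, zero_comp]
    · simp [h]
    · intro l _ hl
      rw [ηApp_entry_of_ne _ (by simpa using hl), comp_zero]
    · simp [h]
  · rw [Finset.sum_eq_zero, Finset.sum_eq_zero]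
    · intro l hl
      rw [Finset.mem_Icc] at hl
      rw [ηApp_entry_of_ne _ (by lia), zero_comp]
    · intro l hl
      rw [Finset.mem_Icc] at hl
      rw [ηApp_entry_of_ne _ (by lia), comp_zero]

lemma shift_ηApp (X : Gr A) : ηApp (shift.obj X) = shift.map (ηApp X) := by
  ext j k
  by_cases h : j + 1 = k
  · subst h
    exact (ηApp_entry_self _ _).trans (ηApp_entry_self X (j + 1)).symm
  · exact (ηApp_entry_of_ne _ h).trans (ηApp_entry_of_ne X (by lia)).symm

/-- The morphism `{φ, 0, 0, …}` of `gr A` given by a family `φ^j : X^j ⟶ Y^j`. -/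
noncomputable def ofDegreeZero {X Y : Gr A} (φ : ∀ j, X.obj j ⟶ Y.obj j) : X ⟶ Y where
  entry j k := if h : j = k then φ j ≫ eqToHom (congr_arg Y.obj h) else 0
  entry_eq_zero _ _ h := dif_neg h.ne'

lemma ofDegreeZero_entry_self {X Y : Gr A} (φ : ∀ j, X.obj j ⟶ Y.obj j) (j : ℤ) :
    (ofDegreeZero φ).entry j j = φ j := by simp [ofDegreeZero]

lemma ofDegreeZero_entry_of_ne {X Y : Gr A} (φ : ∀ j, X.obj j ⟶ Y.obj j) {j k : ℤ} (h : j ≠ k) :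
    (ofDegreeZero φ).entry j k = 0 := dif_neg h

lemma ofDegreeZero_id (X : Gr A) : ofDegreeZero (fun j => 𝟙 (X.obj j)) = 𝟙 X := by
  ext j k
  by_cases h : j = k
  · subst h
    rw [ofDegreeZero_entry_self, id_entry_self]
  · rw [ofDegreeZero_entry_of_ne _ h, id_entry_of_ne _ h]

lemma ofDegreeZero_comp {X Y Z : Gr A} (φ : ∀ j, X.obj j ⟶ Y.obj j) (ψ : ∀ j, Y.obj j ⟶ Z.obj j) :
    ofDegreeZero φ ≫ ofDegreeZero ψ = ofDegreeZero fun j => φ j ≫ ψ j := by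
  ext j k
  rw [comp_entry]
  by_cases h : j = k
  · subst h
    rw [Finset.Icc_self, Finset.sum_singleton, ofDegreeZero_entry_self, ofDegreeZero_entry_self,
      ofDegreeZero_entry_self]
  · rw [ofDegreeZero_entry_of_ne _ h, Finset.sum_eq_zero]
    intro l _
    by_cases hl : j = l
    · rw [ofDegreeZero_entry_of_ne ψ (by lia), comp_zero]
    · rw [ofDegreeZero_entry_of_ne φ hl, zero_comp]

lemma ofDegreeZero_add {X Y : Gr A} (φ ψ : ∀ j, X.obj j ⟶ Y.obj j) :
    ofDegreeZero φ + ofDegreeZero ψ = ofDegreeZero fun j => φ j + ψ j := by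
  ext j k
  rw [add_entry]
  by_cases h : j = k
  · subst h
    simp only [ofDegreeZero_entry_self]
  · simp only [ofDegreeZero_entry_of_ne _ h, add_zero]

lemma ofDegreeZero_zero {X Y : Gr A} :
    ofDegreeZero (fun j => (0 : X.obj j ⟶ Y.obj j)) = 0 := by
  ext j k
  by_cases h : j = k
  · subst h
    exact ofDegreeZero_entry_self _ _
  · exact ofDegreeZero_entry_of_ne _ h

/-- The graded objects `X` with only finitely many nonzero `X^j`. -/
def IsBounded : ObjectProperty (Gr A) := fun X => {j : ℤ | ¬ IsZero (X.obj j)}.Finite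

end Gr

/-- The category `gr^b A`, a full subcategory of `gr A`. -/
abbrev GrB (A : Type u) [Category.{v} A] [Preadditive A] :=
  (Gr.IsBounded (A := A)).FullSubcategory

namespace GrB

variable (A : Type u) [Category.{v} A] [Preadditive A]

lemma isBounded_shift (X : GrB A) : Gr.IsBounded (Gr.shift.obj X.obj) :=
  X.property.preimage (add_left_injective (1 : ℤ)).injOn

/-- The functor `(1)` and the natural transformation `η : (1) ⟶ Id` on `gr^b A`. -/
noncomputable def twist : Twist (GrB A) where
  T := ObjectProperty.lift _ (ObjectProperty.ι _ ⋙ Gr.shift) (isBounded_shift A)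
  additive := ⟨rfl⟩
  η :=
    { app := fun X => ObjectProperty.homMk (Gr.ηApp X.obj)
      naturality := fun _ _ f => ObjectProperty.hom_ext _ (Gr.ηApp_naturality f.hom) }
  comm X := ObjectProperty.hom_ext _ (Gr.shift_ηApp X.obj)

instance [HasZeroObject A] : HasZeroObject (GrB A) := by
  obtain ⟨Z, hZ⟩ := HasZeroObject.zero (C := A)
  refine ⟨⟨⟨fun _ => Z⟩, by simp [Gr.IsBounded, hZ]⟩, ?_⟩
  rw [IsZero.iff_id_eq_zero]
  refine ObjectProperty.hom_ext _ (Gr.hom_ext fun _ _ => ?_)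
  exact hZ.eq_of_src _ _

lemma isBounded_biprod [HasBinaryBiproducts A] (X Y : GrB A) :
    Gr.IsBounded (A := A) ⟨fun j => X.obj.obj j ⊞ Y.obj.obj j⟩ := by
  refine (X.property.union Y.property).subset fun j hj => ?_
  by_contra h
  simp only [Set.mem_union, Set.mem_ofPred_eq, not_or, not_not] at h
  exact hj ((biprod_isZero_iff _ _).2 h)

/-- The direct sum in `gr^b A` is formed degreewise. -/
noncomputable def bicone [HasBinaryBiproducts A] (X Y : GrB A) : BinaryBicone X Y where
  pt := ⟨⟨fun j => X.obj.obj j ⊞ Y.obj.obj j⟩, isBounded_biprod A X Y⟩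
  fst := ObjectProperty.homMk (Gr.ofDegreeZero fun _ => biprod.fst)
  snd := ObjectProperty.homMk (Gr.ofDegreeZero fun _ => biprod.snd)
  inl := ObjectProperty.homMk (Gr.ofDegreeZero fun _ => biprod.inl)
  inr := ObjectProperty.homMk (Gr.ofDegreeZero fun _ => biprod.inr)
  inl_fst := ObjectProperty.hom_ext _ ((Gr.ofDegreeZero_comp _ _).trans
    (by simpa only [biprod.inl_fst] using! Gr.ofDegreeZero_id _))
  inl_snd := ObjectProperty.hom_ext _ ((Gr.ofDegreeZero_comp _ _).trans
    (by simpa only [biprod.inl_snd] using! Gr.ofDegreeZero_zero))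
  inr_fst := ObjectProperty.hom_ext _ ((Gr.ofDegreeZero_comp _ _).trans
    (by simpa only [biprod.inr_fst] using! Gr.ofDegreeZero_zero))
  inr_snd := ObjectProperty.hom_ext _ ((Gr.ofDegreeZero_comp _ _).trans
    (by simpa only [biprod.inr_snd] using! Gr.ofDegreeZero_id _))

lemma bicone_total [HasBinaryBiproducts A] (X Y : GrB A) :
    (bicone A X Y).fst ≫ (bicone A X Y).inl + (bicone A X Y).snd ≫ (bicone A X Y).inr =
      𝟙 (bicone A X Y).pt := by
  refine ObjectProperty.hom_ext _ ?_
  refine (congr_arg₂ (· + ·) (Gr.ofDegreeZero_comp _ _) (Gr.ofDegreeZero_comp _ _)).trans ?_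
  refine (Gr.ofDegreeZero_add _ _).trans ?_
  exact (congr_arg Gr.ofDegreeZero (funext fun _ => biprod.total)).trans (Gr.ofDegreeZero_id _)

instance [HasBinaryBiproducts A] : HasBinaryBiproducts (GrB A) where
  has_binary_biproduct X Y := hasBinaryBiproduct_of_total (bicone A X Y) (bicone_total A X Y)

variable {A}

/-- The finite set of those `j` such that `X^j` is nonzero. -/
noncomputable def support (X : GrB A) : Finset ℤ := Set.Finite.toFinset X.property

lemma isZero_of_notMem_support (X : GrB A) {j : ℤ} (h : j ∉ X.support) :
    IsZero (X.obj.obj j) := by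
  by_contra h'
  exact h ((Set.Finite.mem_toFinset X.property).2 h')

lemma sum_support {X Y Z : GrB A} (f : X ⟶ Y) (g : Y ⟶ Z) (j k : ℤ) :
    ∑ l : Y.support, f.hom.entry j l ≫ g.hom.entry l k = (f ≫ g).hom.entry j k := by
  rw [Finset.sum_coe_sort Y.support fun l => f.hom.entry j l ≫ g.hom.entry l k,
    ObjectProperty.FullSubcategory.comp_hom, Gr.comp_entry]
  have h1 : ∀ l ∈ Y.support, l ∉ Y.support ∩ Finset.Icc j k →
      f.hom.entry j l ≫ g.hom.entry l k = 0 := fun l hl hl' => by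
    by_cases h : l < j
    · rw [f.hom.entry_eq_zero _ _ h, zero_comp]
    · rw [g.hom.entry_eq_zero l k (by grind), comp_zero]
  have h2 : ∀ l ∈ Finset.Icc j k, l ∉ Y.support ∩ Finset.Icc j k →
      f.hom.entry j l ≫ g.hom.entry l k = 0 := fun l hl hl' => by
    rw [(isZero_of_notMem_support Y (j := l) (by grind)).eq_of_tgt (f.hom.entry j l) 0, zero_comp]
  rw [← Finset.sum_subset Finset.inter_subset_left h1,
    ← Finset.sum_subset Finset.inter_subset_right h2]

variable [HasFiniteBiproducts A]

variable (A) in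
/-- The functor `Ξ : gr^b A ⥤ A` which sends `X` to `⨁_j X^j`, and a morphism `f` to the lower
triangular matrix with entries `f_{k-j}^j : X^j ⟶ Y^k` for `j ≤ k`. -/
noncomputable def Ξ : GrB A ⥤ A where
  obj X := ⨁ fun j : X.support => X.obj.obj j
  map {X Y} f := biproduct.matrix fun (j : X.support) (k : Y.support) => f.hom.entry j k
  map_id X := by
    ext j k
    by_cases h : k = j
    · subst h
      simp
    · simp [biproduct.ι_π_ne _ h, Gr.id_entry_of_ne _ (Subtype.coe_injective.ne h)]
  map_comp {X Y Z} f g := by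
    ext j k
    simpa [biproduct.lift_desc] using (sum_support f g k j).symm

instance : (Ξ A).Additive where
  map_add {X Y f g} := by
    have h (a b : ⨁ (fun j : X.support => X.obj.obj j) ⟶ ⨁ fun k : Y.support => Y.obj.obj k)
        (c) (hc : ∀ j k, biproduct.components c j k =
          biproduct.components a j k + biproduct.components b j k) : c = a + b := by
      ext k j
      simpa [biproduct.components] using hc j k
    exact h _ _ _ fun j k => by
      simp only [Ξ, biproduct.matrix_components]
      rfl

end GrB

/-!
The functor `Ξ : gr^b A ⥤ A` turns `η` into an isomorphism: `X(1)` has the same nonzero components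
as `X`, with indices lowered by one, and `Ξ(η_X)` is the permutation matrix that matches them
(`GrB.isIso_Ξ_map_η`). This is all that is used about `Ξ` besides additivity.

Let `H : C(B) ⥤ D` be an additive functor to a pretriangulated category which commutes with shifts,
identifies homotopic maps, sends mapping cone triangles to distinguished triangles, and inverts
the maps `η_K : K(1) ⟶ K`. If `J` is injective with respect to the `η`-conflations, then `η_J` is
null-homotopic, so that `H(η_J)` is both zero and invertible. Hence `H(J) = 0`, and `H` factors
through `K_η(B)` (`Twist.map_eq_of_stableRel`).

The standard triangle of `f : K ⟶ L` in `K_η(B)` has third term the cone of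
`f η_K : K(1) ⟶ L`, and `H(η_K)` identifies its image with the image of the mapping cone triangle of
`f η_K`. The isomorphism `F(K(1)[1]) ≅ F(K)[1]` is `H(η_K)[1]` up to sign; the sign is needed since
the last map of a mapping cone triangle in Mathlib is `-(1 0)`, rather than `(1 0)`
(`Twist.isTriangleFunctor_lift`). For `H` one takes `Ξ` followed by `C(A) ⥤ K(A)`.
-/

/-- A matrix whose nonzero entries are isomorphisms and are placed along a bijection of the index
sets is an isomorphism. -/
lemma CategoryTheory.Limits.biproduct.isIso_matrix {C : Type u} [Category.{v} C] [Preadditive C]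
    [HasFiniteBiproducts C] {J K : Type} [Finite J] [Finite K] {f : J → C} {g : K → C}
    (m : ∀ j k, f j ⟶ g k) (e : J ≃ K) (h : ∀ j, IsIso (m j (e j)))
    (h' : ∀ j k, e j ≠ k → m j k = 0) : IsIso (biproduct.matrix m) := by
  have : biproduct.matrix m =
      (biproduct.whiskerEquiv e fun j => (asIso (m j (e j))).symm).hom := by
    ext k j
    by_cases hk : e j = k
    · subst hk
      simp
    · simp [h' j k hk, biproduct.ι_π_ne _ hk]
  rw [this]
  infer_instance

namespace Twist

open Pretriangulated CochainComplex.HomComplex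

variable {B : Type u} [Category.{v} B] [Preadditive B] (τ : Twist B)
  {D : Type u'} [Category.{v'} D] [Preadditive D]

/-- The natural isomorphism `H(K(1)[1]) ≅ H(K)[1]` given by `-H(η_K)[1]`, for a functor `H` which
commutes with shifts and inverts the maps `η_K`. -/
noncomputable def suspIso [HasShift D ℤ] [∀ n : ℤ, (shiftFunctor D n).Additive]
    (H : CochainComplex B ℤ ⥤ D) [H.CommShift ℤ] [∀ K, IsIso (H.map (τ.ηC K))] :
    τ.suspC ⋙ H ≅ H ⋙ shiftFunctor D (1 : ℤ) :=
  -NatIso.ofComponents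
    (fun K => (H.commShiftIso (1 : ℤ)).app (τ.TC.obj K) ≪≫
      (shiftFunctor D (1 : ℤ)).mapIso (asIso (H.map (τ.ηC K))))
    (fun f => by simp [← Functor.map_comp, ηC_naturality])

variable [HasBinaryBiproducts B]

lemma triangle_mor₃_eq_neg_coneProj {K L : CochainComplex B ℤ} (f : K ⟶ L) :
    (CochainComplex.mappingCone.triangle f).mor₃ = -coneProj f := by
  ext n
  simp [CochainComplex.mappingCone.triangle, coneProj,
    Cochain.rightShift_v _ 1 0 (zero_add 1) n n (add_zero n) (n + 1) rfl]
  rfl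

lemma map_eq_of_stableRel (H : CochainComplex B ℤ ⥤ D) [H.Additive]
    (hH : ∀ ⦃K L : CochainComplex B ℤ⦄ (f g : K ⟶ L), Homotopy f g → H.map f = H.map g)
    [∀ K, IsIso (H.map (τ.ηC K))] ⦃X Y : CochainComplex B ℤ⦄ (f g : X ⟶ Y)
    (h : StableRel τ.conflation f g) : H.map f = H.map g := by
  obtain ⟨J, a, b, hJ, hab⟩ := h
  obtain ⟨h⟩ := τ.nonempty_homotopy_of_relInjective hJ
  have h0 : H.map (τ.ηC J) = 0 := (hH _ _ h).trans (H.map_zero _ _)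
  have hb : H.map b = 0 := by
    rw [← cancel_epi (H.map (τ.ηC J)), h0, zero_comp, zero_comp]
  rw [← sub_eq_zero, ← H.map_sub, hab, H.map_comp, hb, comp_zero]

variable [HasZeroObject B]

instance : τ.quot.Additive := CategoryTheory.Quotient.functor_additive _ _

variable [HasShift D ℤ] [HasZeroObject D] [∀ n : ℤ, (shiftFunctor D n).Additive]
  [Pretriangulated D]

theorem isTriangleFunctor_lift (H : CochainComplex B ℤ ⥤ D) [H.Additive] [H.CommShift ℤ]
    [∀ K, IsIso (H.map (τ.ηC K))]
    (hH : ∀ ⦃X Y : CochainComplex B ℤ⦄ (f g : X ⟶ Y),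
      StableRel τ.conflation f g → H.map f = H.map g)
    (hcone : ∀ ⦃K L : CochainComplex B ℤ⦄ (f : K ⟶ L),
      H.mapTriangle.obj (CochainComplex.mappingCone.triangle f) ∈ distTriang D) :
    τ.IsTriangleFunctor (CategoryTheory.Quotient.lift (StableRel τ.conflation) H hH) := by
  set F := CategoryTheory.Quotient.lift (StableRel τ.conflation) H hH
  have : (τ.quot ⋙ F).Additive := inferInstanceAs H.Additive
  let φ : τ.susp ⋙ F ≅ F ⋙ shiftFunctor D (1 : ℤ) :=
    CategoryTheory.Quotient.natIsoLift (StableRel τ.conflation) (τ.suspIso H)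
  refine ⟨Functor.additive_of_full_essSurj_comp τ.quot F, φ, ?_⟩
  rintro X Y Z u v w ⟨K, L, f, a, b, c, hu, hv, hw⟩
  let e : H.obj (τ.TC.obj K) ≅ H.obj K := asIso (H.map (τ.ηC K))
  have he : e.inv ≫ H.map (τ.ηC K) = 𝟙 (H.obj K) := e.inv_hom_id
  have he' : H.map (τ.ηC K) ≫ e.inv = 𝟙 (H.obj (τ.TC.obj K)) := e.hom_inv_id
  -- On the first terms, `F(X) ≅ H(K)` is corrected by `H(η_K)`, since the mapping cone triangle of
  -- `τ.ηC K ≫ f` starts at `K(1)`.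
  refine isomorphic_distinguished _ (hcone (τ.ηC K ≫ f)) _ (Triangle.isoMk _ _
    (F.mapIso a ≪≫ e.symm) (F.mapIso b) (F.mapIso c) ?_ ?_ ?_)
  · have h : F.map u ≫ F.map b.hom = F.map a.hom ≫ H.map f :=
      (F.map_comp _ _).symm.trans ((F.congr_map hu).trans (F.map_comp _ _))
    change F.map u ≫ F.map b.hom = (F.map a.hom ≫ e.inv) ≫ H.map (τ.ηC K ≫ f)
    rw [h, H.map_comp, Category.assoc, reassoc_of% he]
  · exact (F.map_comp _ _).symm.trans ((F.congr_map hv).trans (F.map_comp _ _))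
  · let s : F.obj (τ.susp.obj X) ⟶ H.obj ((shiftFunctor _ (1 : ℤ)).obj (τ.TC.obj K)) :=
      F.map (τ.susp.map a.hom)
    have h : F.map w ≫ s = F.map c.hom ≫ H.map (coneProj (τ.ηC K ≫ f)) :=
      (F.map_comp _ _).symm.trans ((F.congr_map hw).trans (F.map_comp _ _))
    have hφ : φ.hom.app X ≫ (shiftFunctor D (1 : ℤ)).map (F.map a.hom) =
        s ≫ (-((H.commShiftIso (1 : ℤ)).hom.app (τ.TC.obj K) ≫
          (shiftFunctor D (1 : ℤ)).map (H.map (τ.ηC K)))) := (φ.hom.naturality a.hom).symm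
    let δ : H.obj (CochainComplex.mappingCone (τ.ηC K ≫ f)) ⟶
        H.obj ((shiftFunctor _ (1 : ℤ)).obj (τ.TC.obj K)) :=
      H.map (CochainComplex.mappingCone.triangle (τ.ηC K ≫ f)).mor₃
    have hδ : δ = -H.map (coneProj (τ.ηC K ≫ f)) :=
      (H.congr_map (triangle_mor₃_eq_neg_coneProj _)).trans H.map_neg
    change (F.map w ≫ φ.hom.app X) ≫
        (shiftFunctor D (1 : ℤ)).map (F.map a.hom ≫ e.inv) =
      F.map c.hom ≫ δ ≫ (H.commShiftIso (1 : ℤ)).hom.app (τ.TC.obj K)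
    rw [hδ, Functor.map_comp, Category.assoc, reassoc_of% hφ, reassoc_of% h]
    simp [← Functor.map_comp, he']

end Twist

namespace GrB

variable {A : Type u} [Category.{v} A] [Preadditive A] [HasFiniteBiproducts A]

/-- The bijection `j ↦ j + 1` from the support of `X(1)` to the support of `X`. -/
def supportShiftEquiv (X : GrB A) : ((twist A).T.obj X).support ≃ X.support :=
  (Equiv.addRight (1 : ℤ)).subtypeEquiv fun _ =>
    (Set.Finite.mem_toFinset _).trans (Set.Finite.mem_toFinset X.property).symm

instance isIso_Ξ_map_η (X : GrB A) : IsIso ((Ξ A).map ((twist A).η.app X)) :=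
  biproduct.isIso_matrix (f := fun j : ((twist A).T.obj X).support => X.obj.obj (j + 1))
    (g := fun k : X.support => X.obj.obj k) _ (supportShiftEquiv X)
    (fun j => by
      have h : ((twist A).η.app X).hom.entry j (supportShiftEquiv X j) = 𝟙 (X.obj.obj (j + 1)) :=
        Gr.ηApp_entry_self X.obj j
      exact h ▸ inferInstanceAs (IsIso (𝟙 (X.obj.obj (j + 1)))))
    (fun _ _ h => Gr.ηApp_entry_of_ne X.obj fun h' => h (Subtype.ext h'))

instance isIso_mapHomologicalComplex_map_ηC (K : CochainComplex (GrB A) ℤ) :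
    IsIso (((Ξ A).mapHomologicalComplex (ComplexShape.up ℤ)).map ((twist A).ηC K)) := by
  have (i : ℤ) : IsIso
      ((((Ξ A).mapHomologicalComplex (ComplexShape.up ℤ)).map ((twist A).ηC K)).f i) :=
    isIso_Ξ_map_η (K.X i)
  exact HomologicalComplex.Hom.isIso_of_components _

end GrB

/-- The functor `Ξ : C(gr^b A) ⥤ C(A)` induces a triangle functor `K_η(gr^b A) ⥤ K(A)`. -/
theorem mainTheorem6 {A : Type u} [Category.{v} A] [Preadditive A] [HasFiniteBiproducts A] :
    ∃ F : (GrB.twist A).StableK ⥤ HomotopyCategory A (ComplexShape.up ℤ),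
      (GrB.twist A).quot ⋙ F =
        (GrB.Ξ A).mapHomologicalComplex (ComplexShape.up ℤ) ⋙
          HomotopyCategory.quotient A (ComplexShape.up ℤ) ∧
      (GrB.twist A).IsTriangleFunctor F := by
  let H := (GrB.Ξ A).mapHomologicalComplex (ComplexShape.up ℤ) ⋙
    HomotopyCategory.quotient A (ComplexShape.up ℤ)
  have (K : CochainComplex (GrB A) ℤ) : IsIso (H.map ((GrB.twist A).ηC K)) :=
    inferInstanceAs (IsIso ((HomotopyCategory.quotient A (ComplexShape.up ℤ)).map _))
  have hH := (GrB.twist A).map_eq_of_stableRel H fun _ _ _ _ h =>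
    HomotopyCategory.eq_of_homotopy _ _ ((GrB.Ξ A).mapHomotopy h)
  refine ⟨_, CategoryTheory.Quotient.lift_spec _ H hH, Twist.isTriangleFunctor_lift _ H hH ?_⟩
  intro K L f
  exact Pretriangulated.isomorphic_distinguished _
    (HomotopyCategory.mappingCone_triangleh_distinguished
      (((GrB.Ξ A).mapHomologicalComplex (ComplexShape.up ℤ)).map f)) _
    ((Functor.mapTriangleCompIso _ _).app _ ≪≫
      (HomotopyCategory.quotient A (ComplexShape.up ℤ)).mapTriangle.mapIso
        (CochainComplex.mappingCone.mapTriangleIso f (GrB.Ξ A)))
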